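/- Let $\Gamma$ be a commutative cancellative torsionless monoid (written additively; that is, its quotient group $\langle\Gamma\rangle$ is torsion-free), let $R=\bigoplus_{\alpha\in\Gamma}R_\alpha$ be a $\Gamma$-graded (commutative) integral domain with quotient field $K$, let $H$ be the multiplicative set of nonzero homogeneous elements of $R$, and let $R_H\subseteq K$ be the ring of fractions $a/h$ with $a\in R$, $h\in H$, with its natural $\langle\Gamma\rangle$-grading. For $a\in R$ (respectively $a\in R_H$) let $C(a)$ be the ideal of $R$ (respectively the $R$-submodule of $K$) generated by the homogeneous components of $a$, and for a polynomial $f=f_0+f_1X+\cdots+f_nX^n$ over $R$ or $R_H$ put $\mathcal{A}_f:=\sum_{i=0}^n C(f_i)$. For an $R$-submodule $E\neq 0$ of $K$ put $E^{-1}:=\{x\in K\mid xE\subseteq R\}$ and $E^v:=(E^{-1})^{-1}$, where $(0)^{-1}:=K$; and let $E\,R[X]$ be the set of finite sums of products $eg$ with $e\in E$ and $g\in R[X]$. A semistar operation on $R$ is a map $E\mapsto E^\star$ from the set of nonzero $R$-submodules of $K$ to itself such that, for all $0\ne x\in K$ and all nonzero $R$-submodules $E,F$ of $K$: $(xE)^\star=xE^\star$;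 $E\subseteq F$ implies $E^\star\subseteq F^\star$; $E\subseteq E^\star$; and $(E^\star)^\star=E^\star$. It is called a (semi)star operation if moreover $R^\star=R$. Then the following are equivalent: 1. $R$ is integrally closed (in $K$). 2. $(\mathcal{A}_f\mathcal{A}_g)^v=(\mathcal{A}_{fg})^v$ for all nonzero $f,g\in R[X]$. 3. There is a (semi)star operation $\star$ on $R$ such that $(\mathcal{A}_f\mathcal{A}_g)^\star=(\mathcal{A}_{fg})^\star$ for all nonzero $f,g\in R_H[X]$ with $f$ linear (that is, of degree $1$). 4. $fR_H[X]\cap R[X]=f\mathcal{A}_f^{-1}R[X]$ for all nonzero $f\in R[X]$. -/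

import Mathlib

open Polynomial DirectSum
open scoped Pointwise

noncomputable section

namespace GradedDomain

/-! ### The homogeneous quotient field and its grading -/

/-- The degree of a homogeneous element, read in the quotient group `⟨Γ⟩` of `Γ`. -/
abbrev deg {Γ : Type*} [AddCancelCommMonoid Γ] (α : Γ) : Algebra.GrothendieckAddGroup Γ :=
  Algebra.GrothendieckAddGroup.of α

theorem deg_injective {Γ : Type*} [AddCancelCommMonoid Γ] :
    Function.Injective (deg : Γ → Algebra.GrothendieckAddGroup Γ) :=
  Algebra.GrothendieckAddGroup.of_injective

section Grading

variable {Γ : Type*} [AddCancelCommMonoid Γ] [DecidableEq Γ] {R : Type*} [CommRing R] [IsDomain R]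
  (𝒜 : Γ → AddSubgroup R) [GradedRing 𝒜] (K : Type*) [Field K] [Algebra R K] [IsFractionRing R K]

/-- The multiplicative set `H` of nonzero homogeneous elements of the graded domain `R`. -/
def nonzeroHomogeneous : Submonoid R :=
  SetLike.homogeneousSubmonoid 𝒜 ⊓ nonZeroDivisors R

/-- The homogeneous quotient field `R_H`, as a subring of the quotient field `K` of `R`. -/
abbrev homogQuot : Subalgebra R K :=
  Localization.subalgebra.ofField K (nonzeroHomogeneous 𝒜) inf_le_right

instance : IsLocalization (nonzeroHomogeneous 𝒜) (homogQuot 𝒜 K) :=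
  Localization.subalgebra.isLocalization_ofField K (nonzeroHomogeneous 𝒜) inf_le_right

/-- The homogeneous component of degree `γ ∈ ⟨Γ⟩` of `R_H`: zero and the fractions `a / h` with
`a` homogeneous of degree `α`, `h ≠ 0` homogeneous of degree `β`, and `α - β = γ`. -/
def homogQuotComponent (γ : Algebra.GrothendieckAddGroup Γ) : AddSubgroup (homogQuot 𝒜 K) where
  carrier := {x | x = 0 ∨ ∃ α β : Γ, deg α - deg β = γ ∧ ∃ a ∈ 𝒜 α, ∃ h ∈ 𝒜 β, h ≠ 0 ∧
    (x : K) = algebraMap R K a / algebraMap R K h}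
  zero_mem' := Or.inl rfl
  add_mem' := by
    rintro x y (rfl | ⟨α, β, rfl, a, ha, h, hh, h0, hx⟩) hy
    · simpa using hy
    rcases hy with rfl | ⟨α', β', hγ, a', ha', h', hh', h0', hy⟩
    · exact Or.inr ⟨α, β, rfl, a, ha, h, hh, h0, by simpa using hx⟩
    have e : β + α' = α + β' := by
      apply deg_injective
      have := sub_eq_sub_iff_add_eq_add.mp hγ
      simp only [deg, map_add] at this ⊢
      rw [add_comm, this]
    refine Or.inr ⟨α + β', β + β', by simp [deg], a * h' + h * a',
      add_mem (SetLike.mul_mem_graded ha hh') (e ▸ SetLike.mul_mem_graded hh ha'),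
      h * h', SetLike.mul_mem_graded hh hh', mul_ne_zero h0 h0', ?_⟩
    have i0 : algebraMap R K h ≠ 0 := by simpa using h0
    have i0' : algebraMap R K h' ≠ 0 := by simpa using h0'
    simp only [AddMemClass.coe_add, hx, hy, map_add, map_mul]
    rw [div_add_div _ _ i0 i0']
  neg_mem' := by
    rintro x (rfl | ⟨α, β, rfl, a, ha, h, hh, h0, hx⟩)
    · exact Or.inl neg_zero
    · exact Or.inr ⟨α, β, rfl, -a, neg_mem ha, h, hh, h0, by simp [hx, neg_div]⟩

instance : SetLike.GradedMonoid (homogQuotComponent 𝒜 K) where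
  one_mem := Or.inr ⟨0, 0, by simp, 1, SetLike.one_mem_graded 𝒜, 1, SetLike.one_mem_graded 𝒜,
    one_ne_zero, by simp⟩
  mul_mem := by
    rintro γ δ x y (rfl | ⟨α, β, rfl, a, ha, h, hh, h0, hx⟩) hy
    · exact Or.inl (zero_mul y)
    rcases hy with rfl | ⟨α', β', rfl, a', ha', h', hh', h0', hy⟩
    · exact Or.inl (mul_zero x)
    refine Or.inr ⟨α + α', β + β', ?_, a * a', SetLike.mul_mem_graded ha ha', h * h',
      SetLike.mul_mem_graded hh hh', mul_ne_zero h0 h0', ?_⟩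
    · simp only [deg, map_add]; abel
    · simp [hx, hy, div_mul_div_comm]

theorem algebraMap_mem_component {α : Γ} {a : R} (ha : a ∈ 𝒜 α) :
    algebraMap R (homogQuot 𝒜 K) a ∈ homogQuotComponent 𝒜 K (deg α) :=
  Or.inr ⟨α, 0, by simp [deg], a, ha, 1, SetLike.one_mem_graded 𝒜, one_ne_zero, by
    simp only [map_one, div_one]; rfl⟩

/-- The inclusion of `R_α` into the component of `R_H` of the same degree. -/
def componentInclusion (α : Γ) : 𝒜 α →+ homogQuotComponent 𝒜 K (deg α) where
  toFun a := ⟨algebraMap R (homogQuot 𝒜 K) a, algebraMap_mem_component 𝒜 K a.2⟩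
  map_zero' := by ext; simp
  map_add' a b := by ext; simp

/-- The decomposition of the elements of `R` inside `R_H`. -/
def decomposeBase [DecidableEq (Algebra.GrothendieckAddGroup Γ)] : R →+* ⨁ γ, homogQuotComponent 𝒜 K γ :=
  (DirectSum.toSemiring
    (fun α => (DirectSum.of (fun γ => homogQuotComponent 𝒜 K γ) (deg α)).comp
      (componentInclusion 𝒜 K α))
    (by
      rw [DirectSum.one_def]
      refine DirectSum.of_eq_of_gradedMonoid_eq (Sigma.subtype_ext ?_ ?_)
      · exact map_zero Algebra.GrothendieckAddGroup.of
      · exact map_one (algebraMap R (homogQuot 𝒜 K)))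
    (by
      intro α β a b
      simp only [AddMonoidHom.comp_apply]
      rw [DirectSum.of_mul_of]
      refine DirectSum.of_eq_of_gradedMonoid_eq (Sigma.subtype_ext ?_ ?_)
      · exact map_add Algebra.GrothendieckAddGroup.of α β
      · exact map_mul (algebraMap R (homogQuot 𝒜 K)) _ _)).comp
  (DirectSum.decomposeRingEquiv 𝒜).toRingHom

theorem decomposeBase_of_mem [DecidableEq (Algebra.GrothendieckAddGroup Γ)]
    {α : Γ} {a : R} (ha : a ∈ 𝒜 α) :
    decomposeBase 𝒜 K a = DirectSum.of (fun γ => homogQuotComponent 𝒜 K γ) (deg α)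
      ⟨algebraMap R (homogQuot 𝒜 K) a, algebraMap_mem_component 𝒜 K ha⟩ := by
  have : DirectSum.decomposeRingEquiv 𝒜 a = DirectSum.of (fun α => 𝒜 α) α ⟨a, ha⟩ :=
    DirectSum.decompose_of_mem 𝒜 ha
  change DirectSum.toAddMonoid _ (DirectSum.decomposeRingEquiv 𝒜 a) = _
  rw [this, DirectSum.toAddMonoid_of]
  rfl

theorem isUnit_decomposeBase [DecidableEq (Algebra.GrothendieckAddGroup Γ)]
    (s : nonzeroHomogeneous 𝒜) : IsUnit (decomposeBase 𝒜 K s) := by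
  obtain ⟨h, ⟨β, hβ⟩, hs⟩ := s
  have h0 : h ≠ 0 := nonZeroDivisors.ne_zero hs
  have i0 : algebraMap R K h ≠ 0 := by simpa using h0
  let y : homogQuot 𝒜 K := ⟨(algebraMap R K h)⁻¹, 1, h, ⟨⟨β, hβ⟩, hs⟩, by simp⟩
  have hy : y ∈ homogQuotComponent 𝒜 K (-deg β) :=
    Or.inr ⟨0, β, by simp [deg], 1, SetLike.one_mem_graded 𝒜, h, hβ, h0, by simp [y]⟩
  refine IsUnit.of_mul_eq_one (DirectSum.of (fun γ => homogQuotComponent 𝒜 K γ) _ ⟨y, hy⟩) ?_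
  rw [decomposeBase_of_mem 𝒜 K hβ, DirectSum.of_mul_of, DirectSum.one_def]
  refine DirectSum.of_eq_of_gradedMonoid_eq (Sigma.subtype_ext ?_ ?_)
  · exact add_neg_cancel (deg β)
  · exact Subtype.ext (mul_inv_cancel₀ i0)

/-- The homogeneous quotient field is graded by `⟨Γ⟩`. -/
instance instGradedRingHomogQuot [DecidableEq (Algebra.GrothendieckAddGroup Γ)] :
    GradedRing (homogQuotComponent 𝒜 K) := by
  let Φ : homogQuot 𝒜 K →+* ⨁ γ, homogQuotComponent 𝒜 K γ :=
    IsLocalization.lift (M := nonzeroHomogeneous 𝒜) (isUnit_decomposeBase 𝒜 K)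
  have hΦ (r : R) : Φ (algebraMap R _ r) = decomposeBase 𝒜 K r := IsLocalization.lift_eq _ r
  have h1 : (DirectSum.coeRingHom (homogQuotComponent 𝒜 K)).comp Φ = RingHom.id _ := by
    refine IsLocalization.ringHom_ext (nonzeroHomogeneous 𝒜) (RingHom.ext fun r => ?_)
    simp only [RingHom.comp_apply, RingHom.id_apply, hΦ]
    induction r using DirectSum.Decomposition.inductionOn 𝒜 with
    | zero => simp
    | homogeneous a => rw [decomposeBase_of_mem 𝒜 K a.2, DirectSum.coeRingHom_of]
    | add a b ha hb => simp only [map_add, ha, hb]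
  have h2 : Φ.toAddMonoidHom.comp (DirectSum.coeAddMonoidHom (homogQuotComponent 𝒜 K)) =
      AddMonoidHom.id _ := by
    refine DirectSum.addHom_ext' fun γ => AddMonoidHom.ext fun x => ?_
    obtain ⟨x, rfl | ⟨α, β, hγ, a, ha, h, hh, h0, hx⟩⟩ := x
    · exact (map_zero _).trans (map_zero _).symm
    simp only [AddMonoidHom.comp_apply, DirectSum.coeAddMonoidHom_of, AddMonoidHom.id_apply]
    change Φ x = DirectSum.of (fun γ => homogQuotComponent 𝒜 K γ) γ ⟨x, _⟩
    have hs : h ∈ nonzeroHomogeneous 𝒜 := ⟨⟨β, hh⟩, mem_nonZeroDivisors_of_ne_zero h0⟩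
    have i0 : algebraMap R K h ≠ 0 := by simpa using h0
    have e : x * algebraMap R _ h = algebraMap R _ a := by
      refine Subtype.ext ?_
      change (x : K) * algebraMap R K h = algebraMap R K a
      rw [hx, div_mul_cancel₀ _ i0]
    refine (isUnit_decomposeBase 𝒜 K ⟨h, hs⟩).mul_right_cancel ?_
    change Φ x * decomposeBase 𝒜 K h = _ * decomposeBase 𝒜 K h
    rw [← hΦ h, ← map_mul, e, hΦ, hΦ, decomposeBase_of_mem 𝒜 K ha, decomposeBase_of_mem 𝒜 K hh,
      DirectSum.of_mul_of]
    refine DirectSum.of_eq_of_gradedMonoid_eq (Sigma.subtype_ext ?_ ?_)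
    · exact sub_eq_iff_eq_add.mp hγ
    · exact e.symm
  exact { DirectSum.Decomposition.ofAddHom _ Φ.toAddMonoidHom
    (AddMonoidHom.ext fun x => DFunLike.congr_fun h1 x) h2 with }

/-- The component of degree `γ` of an element of `R_H`. -/
def homogQuotProj (γ : Algebra.GrothendieckAddGroup Γ) : homogQuot 𝒜 K →+ homogQuot 𝒜 K :=
  letI := Classical.decEq (Algebra.GrothendieckAddGroup Γ)
  GradedRing.proj (homogQuotComponent 𝒜 K) γ

/-! ### Homogeneous content -/

/-- `C(a)` for `a ∈ R`: the ideal of `R` generated by the homogeneous components of `a`. -/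
def componentIdeal (a : R) : Ideal R :=
  Ideal.span (Set.range fun α => GradedRing.proj 𝒜 α a)

/-- `C(x)` for `x ∈ R_H`: the `R`-submodule of `K` generated by the homogeneous components
of `x`. -/
def componentSubmodule (x : homogQuot 𝒜 K) : Submodule R K :=
  Submodule.span R (Set.range fun γ => (homogQuotProj 𝒜 K γ x : K))

/-- The homogeneous content ideal `𝒜_f = C(f₀) + ⋯ + C(fₙ)` of `f ∈ R[X]`. -/
def content (f : R[X]) : Ideal R :=
  ∑ i ∈ Finset.range (f.natDegree + 1), componentIdeal 𝒜 (f.coeff i)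

/-- The homogeneous content `𝒜_f = C(f₀) + ⋯ + C(fₙ)` of `f ∈ R_H[X]`, a fractional ideal
of `R`. -/
def contentQuot (f : (homogQuot 𝒜 K)[X]) : Submodule R K :=
  ∑ i ∈ Finset.range (f.natDegree + 1), componentSubmodule 𝒜 K (f.coeff i)

end Grading

/-! ### Semistar operations -/

section Semistar

variable (R : Type*) [CommRing R] [IsDomain R] (K : Type*) [Field K] [Algebra R K]
  [IsFractionRing R K]

/-- A semistar operation on the domain `R`: a map on the nonzero `R`-submodules of the quotient
field `K`. The value at the zero submodule is not constrained and carries no meaning; that nonzero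
submodules have nonzero images follows from `le_star`. -/
structure SemistarOperation where
  star : Submodule R K → Submodule R K
  star_smul : ∀ (x : K) (E : Submodule R K), x ≠ 0 → E ≠ ⊥ → star (x • E) = x • star E
  star_mono : ∀ E F : Submodule R K, E ≠ ⊥ → F ≠ ⊥ → E ≤ F → star E ≤ star F
  le_star : ∀ E : Submodule R K, E ≠ ⊥ → E ≤ star E
  star_star : ∀ E : Submodule R K, E ≠ ⊥ → star (star E) = star E

variable {R K}

/-- A (semi)star operation: a semistar operation with `R^⋆ = R`. -/
def SemistarOperation.IsSemiStar (s : SemistarOperation R K) : Prop :=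
  s.star 1 = 1

/-- `E⁻¹ = (R : E) = {x ∈ K | x E ⊆ R}`. -/
def inverse (E : Submodule R K) : Submodule R K := 1 / E

/-- `E^v = (E⁻¹)⁻¹`. -/
def vClosure (E : Submodule R K) : Submodule R K := inverse (inverse E)

end Semistar

/-! ### Submodules of `K[X]` -/

section Polynomials

variable {R : Type*} [CommRing R] {K : Type*} [Field K] [Algebra R K]

/-- The image in `K` of an ideal of `R`. -/
def idealToField (K : Type*) [Field K] [Algebra R K] (I : Ideal R) : Submodule R K :=
  Submodule.map (Algebra.linearMap R K) I

/-- The subset `R[X]` of `K[X]`. -/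
def basePoly (R K : Type*) [CommRing R] [Field K] [Algebra R K] : Submodule R K[X] :=
  (mapAlgHom (Algebra.ofId R K)).range.toSubmodule

/-- The subset `T[X]` of `K[X]`, for a ring `T` between `R` and `K`. -/
def overringPoly (T : Subalgebra R K) : Submodule R K[X] :=
  (mapAlgHom T.val).range.toSubmodule

/-- The extension `E R[X]` in `K[X]` of an `R`-submodule `E` of `K`: the set of finite sums of
products `e g` with `e ∈ E` and `g ∈ R[X]`. -/
def extend (E : Submodule R K) : Submodule R K[X] :=
  E.map (CAlgHom (R := R) (A := K)).toLinearMap * basePoly R K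

/-- The product `p M = {p q | q ∈ M}` for `p ∈ K[X]` and `M ⊆ K[X]`. -/
def polyMul (p : K[X]) (M : Submodule R K[X]) : Submodule R K[X] :=
  M.map (LinearMap.mulLeft R p)

end Polynomials

end GradedDomain

end

/-! The core is a content formula for integrally closed `R`: `𝒜_f 𝒜_g` and `𝒜_{fg}` have the same
inverse for all `f`, `g` over `R_H` (`inverse_contentQuot_mul`). Recording degrees in `⟨Γ⟩` and
powers of `X` as exponents maps `R_H[X]` into the monoid algebra `K[⟨Γ⟩ × ℕ]`, where the content of
`f` is the span of the coefficients of its image. Since `⟨Γ⟩` is torsion-free, the exponents have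
unique sums, so every valuation of `K` satisfies Gauss's lemma there (`exists_valuation_mul_le`):
one coefficient of a product dominates all products of coefficients. Hence if `x` multiplies
`𝒜_{fg}` into `R`, it multiplies `𝒜_f 𝒜_g` into every valuation ring of `K` containing `R`, and
these intersect in `R`. Statements 2 and 3 (with the `v`-operation) follow by taking inverses;
statement 4 follows because `fg ∈ R[X]` forces `𝒜_f 𝒜_g ⊆ R`.

Conversely, let `u ∈ K` be a root of a monic `h ∈ R[X]`. The ring `R_H` is integrally closed
(`isIntegrallyClosed_homogQuot`), because any finite part of it lies in a Laurent polynomial ring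
over the field of its elements of degree zero. So `u ∈ R_H` and `h = (X - u) q` with `q` monic over
`R_H`. Each of 2, 3 and 4, applied to this factorization up to homogeneous denominators, puts the
product of the constant coefficient `-u` and the leading coefficient `1` in `R`. -/

noncomputable section

namespace GradedDomain

/-! ### Graded domains whose nonzero homogeneous elements are units -/

/-- A domain is integrally closed if each of its finite subsets lies in an integrally closed
subring. -/
theorem isIntegrallyClosed_of_forall_finset {T : Type*} [CommRing T] [IsDomain T]
    (H : ∀ s : Finset T, ∃ S : Subring T, IsIntegrallyClosed S ∧ ∀ x ∈ s, x ∈ S) :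
    IsIntegrallyClosed T := by
  classical
  rw [isIntegrallyClosed_iff (FractionRing T)]
  rintro u ⟨p, hp, hpu⟩
  obtain ⟨a, b, hb, rfl⟩ := IsFractionRing.div_surjective (A := T) u
  -- With `a`, `b` and the coefficients of the integral equation in `S`, the equation descends to
  -- the fraction `a / b` over `S`.
  obtain ⟨S, hS, hs⟩ := H (insert a (insert b p.coeffs))
  have ha : a ∈ S := hs a (by simp)
  have hbS : b ∈ S := hs b (by simp)
  have hpS : (↑p.coeffs : Set T) ⊆ S := fun x hx => hs x (by
    simp only [Finset.mem_insert]; exact Or.inr (Or.inr hx))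
  have hinj : Function.Injective ((algebraMap T (FractionRing T)).comp S.subtype) :=
    (IsFractionRing.injective T (FractionRing T)).comp Subtype.val_injective
  let j : FractionRing S →+* FractionRing T := IsFractionRing.lift (A := S) hinj
  have hj (x : S) : j (algebraMap S _ x) = algebraMap T (FractionRing T) x :=
    IsFractionRing.lift_algebraMap hinj x
  let w : FractionRing S := algebraMap S _ ⟨a, ha⟩ / algebraMap S _ ⟨b, hbS⟩
  have hw : j w = algebraMap T (FractionRing T) a / algebraMap T (FractionRing T) b := by
    simp [w, map_div₀, hj]
  have hint : IsIntegral S w := by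
    refine ⟨p.toSubring S hpS, (monic_toSubring p S hpS).mpr hp, j.injective ?_⟩
    rw [map_zero, hom_eval₂, hw]
    have e : j.comp (algebraMap S (FractionRing S)) =
        (algebraMap T (FractionRing T)).comp S.subtype := RingHom.ext hj
    rw [e, ← eval₂_map, map_toSubring]
    exact hpu
  obtain ⟨y, hy⟩ := (isIntegrallyClosed_iff (FractionRing S)).mp hS hint
  exact ⟨y, by rw [← hj, hy, hw]⟩

section HomogeneousUnits

variable {G : Type*} [AddCommGroup G] [DecidableEq G]
  {T : Type*} [CommRing T] [IsDomain T] (ℬ : G → AddSubgroup T) [GradedRing ℬ]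

/-- The component of degree zero of a graded ring. -/
def degreeZero : Subring T where
  carrier := ℬ 0
  mul_mem' ha hb := by simpa using SetLike.mul_mem_graded (A := ℬ) ha hb
  one_mem' := SetLike.one_mem_graded ℬ
  add_mem' := add_mem
  zero_mem' := zero_mem _
  neg_mem' := neg_mem

/-- The component of `x * y` in degree `0` is `x` times the component of `y` in degree `-γ`. It
equals `x * y`, and `x` cancels. -/
theorem mem_neg_of_mul_eq_one {γ : G} {x y : T} (hx : x ∈ ℬ γ) (h : x * y = 1) : y ∈ ℬ (-γ) := by
  have h0 : x ≠ 0 := by rintro rfl; simp at h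
  have e := coe_decompose_mul_add_of_left_mem ℬ (j := -γ) (b := y) hx
  rw [h, add_neg_cancel, decompose_of_mem_same ℬ (SetLike.one_mem_graded ℬ)] at e
  have : y = decompose ℬ y (-γ) := mul_left_cancel₀ h0 (h.trans e)
  rw [this]
  exact SetLike.coe_mem _

variable (hu : ∀ γ, ∀ x ∈ ℬ γ, x ≠ 0 → IsUnit x)
include hu

theorem isField_degreeZero : IsField (degreeZero ℬ) where
  exists_pair_ne := ⟨0, 1, zero_ne_one⟩
  mul_comm := mul_comm
  mul_inv_cancel := by
    rintro ⟨x, hx⟩ h0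
    obtain ⟨y, hy⟩ := (hu 0 x hx fun h => h0 (Subtype.ext h)).exists_right_inv
    exact ⟨⟨y, by have := mem_neg_of_mul_eq_one ℬ hx hy; rwa [neg_zero] at this⟩, Subtype.ext hy⟩

/-- The degrees of the nonzero homogeneous elements, when these are units. -/
def degreeSupport : AddSubgroup G where
  carrier := {γ | ∃ x ∈ ℬ γ, x ≠ 0}
  add_mem' := by
    rintro γ δ ⟨x, hx, x0⟩ ⟨y, hy, y0⟩
    exact ⟨x * y, SetLike.mul_mem_graded hx hy, mul_ne_zero x0 y0⟩
  zero_mem' := ⟨1, SetLike.one_mem_graded ℬ, one_ne_zero⟩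
  neg_mem' := by
    rintro γ ⟨x, hx, x0⟩
    obtain ⟨y, hy⟩ := (hu γ x hx x0).exists_right_inv
    exact ⟨y, mem_neg_of_mul_eq_one ℬ hx hy, by rintro rfl; simp at hy⟩

end HomogeneousUnits

/-! ### Laurent polynomial subrings generated by homogeneous units -/

section Monomials

variable {G : Type*} [AddCommGroup G] [DecidableEq G]
  {T : Type*} [CommRing T] [IsDomain T] (ℬ : G → AddSubgroup T) [GradedRing ℬ]
  {n : ℕ} {e : Fin n → G} {t : Fin n → T}

omit [IsDomain T] in
theorem prod_pow_mem (ht : ∀ i, t i ∈ ℬ (e i)) (m : Fin n → ℕ) :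
    ∏ i, t i ^ m i ∈ ℬ (∑ i, m i • e i) :=
  SetLike.prod_mem_graded _ _ _ fun i _ => SetLike.pow_mem_graded _ (ht i)

omit [IsDomain T] in
theorem aeval_monomial_mem (ht : ∀ i, t i ∈ ℬ (e i)) (m : Fin n →₀ ℕ) (c : degreeZero ℬ) :
    MvPolynomial.aeval t (MvPolynomial.monomial m c) ∈ ℬ (∑ i, m i • e i) := by
  rw [MvPolynomial.aeval_monomial, Finsupp.prod_fintype _ _ (by simp)]
  have := SetLike.mul_mem_graded (A := ℬ) c.2 (prod_pow_mem ℬ ht m)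
  rwa [zero_add] at this

/-- Independent degrees give distinct monomials distinct degrees, so taking a homogeneous component
isolates a single term of the polynomial. -/
theorem aeval_injective_of_linearIndependent (ht : ∀ i, t i ∈ ℬ (e i)) (t0 : ∀ i, t i ≠ 0)
    (he : LinearIndependent ℤ e) :
    Function.Injective (MvPolynomial.aeval t : MvPolynomial (Fin n) (degreeZero ℬ) →ₐ[_] T) := by
  have hd : Function.Injective fun m : Fin n →₀ ℕ => ∑ i, m i • e i := by
    intro m m' h
    have := Fintype.linearIndependent_iff.mp he (fun i => (m i : ℤ) - m' i) (by
      simpa [sub_smul, sub_eq_zero] using h)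
    ext i
    have := this i
    omega
  rw [injective_iff_map_eq_zero]
  intro p hp
  ext m
  rw [MvPolynomial.coeff_zero]
  have h1 : GradedRing.proj ℬ (∑ i, m i • e i) (MvPolynomial.aeval t p) =
      MvPolynomial.aeval t (MvPolynomial.monomial m (p.coeff m)) := by
    conv_lhs => rw [p.as_sum, map_sum, map_sum]
    rw [Finset.sum_eq_single m]
    · rw [GradedRing.proj_apply, decompose_of_mem_same ℬ (aeval_monomial_mem ℬ ht _ _)]
    · intro m' _ h
      rw [GradedRing.proj_apply, decompose_of_mem_ne ℬ (aeval_monomial_mem ℬ ht _ _)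
        fun h' => h (hd h')]
    · intro h
      rw [MvPolynomial.notMem_support_iff.mp h]; simp
  rw [hp, map_zero, MvPolynomial.aeval_monomial, Finsupp.prod_fintype _ _ (by simp)] at h1
  have h2 : ∏ i, t i ^ m i ≠ 0 := Finset.prod_ne_zero_iff.mpr fun i _ => pow_ne_zero _ (t0 i)
  exact (mul_eq_zero.mp h1.symm).resolve_right h2

/-- The elements that a power of the product of the `t i` moves into the ring generated by
the `t i` over the component of degree zero. -/
def monomialLocalization (t : Fin n → T) : Subring T where
  carrier := {x | ∃ N : ℕ, (∏ i, t i) ^ N * x ∈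
    (MvPolynomial.aeval t : MvPolynomial (Fin n) (degreeZero ℬ) →ₐ[_] T).range}
  mul_mem' := by
    rintro x y ⟨N, hN⟩ ⟨M, hM⟩
    exact ⟨N + M, by convert mul_mem hN hM using 1; ring⟩
  one_mem' := ⟨0, by simp⟩
  add_mem' := by
    rintro x y ⟨N, hN⟩ ⟨M, hM⟩
    have h : ∏ i, t i ∈ (MvPolynomial.aeval t : MvPolynomial (Fin n) (degreeZero ℬ) →ₐ[_] T).range :=
      prod_mem fun i _ => ⟨MvPolynomial.X i, by simp⟩
    exact ⟨N + M, by
      convert add_mem (mul_mem (pow_mem h M) hN) (mul_mem (pow_mem h N) hM) using 1; ring⟩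
  zero_mem' := ⟨0, by simp⟩
  neg_mem' := by
    rintro x ⟨N, hN⟩
    exact ⟨N, by simpa using neg_mem hN⟩

/-- This is a Laurent polynomial ring over a field: the localization of a polynomial ring, which is
integrally closed, at the product of its variables. -/
theorem isIntegrallyClosed_monomialLocalization
    (hu : ∀ γ, ∀ x ∈ ℬ γ, x ≠ 0 → IsUnit x)
    (ht : ∀ i, t i ∈ ℬ (e i)) (t0 : ∀ i, t i ≠ 0) (he : LinearIndependent ℤ e) :
    IsIntegrallyClosed (monomialLocalization ℬ t) := by
  let _ : Field (degreeZero ℬ) := (isField_degreeZero ℬ hu).toField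
  let φ : MvPolynomial (Fin n) (degreeZero ℬ) →ₐ[_] T := MvPolynomial.aeval t
  have hφ : Function.Injective φ := aeval_injective_of_linearIndependent ℬ ht t0 he
  let _ : Algebra (MvPolynomial (Fin n) (degreeZero ℬ)) (monomialLocalization ℬ t) :=
    (RingHom.codRestrict (φ : MvPolynomial (Fin n) (degreeZero ℬ) →+* T)
      (monomialLocalization ℬ t) fun p =>
        show ∃ N : ℕ, _ ∈ φ.range from ⟨0, p, by simp⟩).toAlgebra
  have hmap (p) : (algebraMap (MvPolynomial (Fin n) (degreeZero ℬ))
      (monomialLocalization ℬ t) p : T) = φ p := rfl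
  have hτ : φ (∏ i, MvPolynomial.X i) = ∏ i, t i := by simp [φ]
  have τ0 : ∏ i, t i ≠ 0 := Finset.prod_ne_zero_iff.mpr fun i _ => t0 i
  have X0 : (∏ i, MvPolynomial.X i : MvPolynomial (Fin n) (degreeZero ℬ)) ≠ 0 := by
    intro h; rw [h, map_zero] at hτ; exact τ0 hτ.symm
  obtain ⟨σ, hσ⟩ := (hu _ _ (by simpa using prod_pow_mem ℬ ht (fun _ => 1)) τ0).exists_right_inv
  have : IsLocalization (Submonoid.powers
      (∏ i, MvPolynomial.X i : MvPolynomial (Fin n) (degreeZero ℬ)))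
      (monomialLocalization ℬ t) := by
    refine ⟨?_, ?_, ?_⟩
    · rintro ⟨_, N, rfl⟩
      rw [map_pow]
      refine IsUnit.pow N (IsUnit.of_mul_eq_one ⟨σ, 1, 1, by simp [hσ]⟩ (Subtype.ext ?_))
      change φ _ * σ = 1
      rw [hτ, hσ]
    · rintro ⟨x, N, p, hp⟩
      refine ⟨⟨p, _, N, rfl⟩, Subtype.ext ?_⟩
      change x * φ _ = φ p
      rw [map_pow, hτ, mul_comm]
      exact hp.symm
    · intro p q h
      exact ⟨1, by rw [hφ (congrArg Subtype.val h)]⟩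
  exact isIntegrallyClosed_of_isLocalization (R := MvPolynomial (Fin n) (degreeZero ℬ)) _
    (Submonoid.powers (∏ i, MvPolynomial.X i)) (powers_le_nonZeroDivisors_of_noZeroDivisors X0)

/-- A large power of the product of the `t i` makes all exponents nonnegative. Dividing by the
monomial of the same degree then leaves a constant of degree zero. -/
theorem mem_monomialLocalization (hu : ∀ γ, ∀ x ∈ ℬ γ, x ≠ 0 → IsUnit x)
    (ht : ∀ i, t i ∈ ℬ (e i)) (t0 : ∀ i, t i ≠ 0) (z : Fin n → ℤ) {x : T}
    (hx : x ∈ ℬ (∑ i, z i • e i)) : x ∈ monomialLocalization ℬ t := by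
  obtain ⟨N, hN⟩ : ∃ N : ℕ, ∀ i, 0 ≤ N + z i := by
    refine ⟨∑ i, (z i).natAbs, fun i => ?_⟩
    have := Finset.single_le_sum (f := fun i => (z i).natAbs) (fun _ _ => Nat.zero_le _)
      (Finset.mem_univ i)
    omega
  let m : Fin n →₀ ℕ := Finsupp.equivFunOnFinite.symm fun i => (N + z i).toNat
  have hm (i) : (m i : ℤ) = N + z i := by simp [m, hN i]
  have h1 : (∏ i, t i) ^ N * x ∈ ℬ (∑ i, m i • e i) := by
    have h := SetLike.mul_mem_graded (A := ℬ)
      (SetLike.pow_mem_graded N (by simpa using prod_pow_mem ℬ ht (fun _ => 1))) hx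
    convert h using 2
    rw [Finset.smul_sum, ← Finset.sum_add_distrib]
    refine Finset.sum_congr rfl fun i _ => ?_
    rw [← natCast_zsmul, hm, add_smul, natCast_zsmul]
  have h2 : ∏ i, t i ^ m i ∈ ℬ (∑ i, m i • e i) := prod_pow_mem ℬ ht m
  obtain ⟨y, hy⟩ := (hu _ _ h2 (Finset.prod_ne_zero_iff.mpr fun i _ =>
    pow_ne_zero _ (t0 i))).exists_right_inv
  have hc : (∏ i, t i) ^ N * x * y ∈ ℬ 0 := by
    simpa using SetLike.mul_mem_graded h1 (mem_neg_of_mul_eq_one ℬ h2 hy)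
  refine ⟨N, MvPolynomial.monomial m ⟨_, hc⟩, ?_⟩
  change MvPolynomial.aeval t _ = _
  rw [MvPolynomial.aeval_monomial, Finsupp.prod_fintype _ _ (by simp)]
  change (∏ i, t i) ^ N * x * y * _ = _
  rw [mul_assoc, mul_comm y, hy, mul_one]

end Monomials

/-- A domain graded by a torsion-free group whose nonzero homogeneous elements are units is
integrally closed. -/
theorem isIntegrallyClosed_of_isUnit_homogeneous {G : Type*} [AddCommGroup G] [IsAddTorsionFree G]
    [DecidableEq G] {T : Type*} [CommRing T] [IsDomain T] (ℬ : G → AddSubgroup T) [GradedRing ℬ]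
    (hu : ∀ γ, ∀ x ∈ ℬ γ, x ≠ 0 → IsUnit x) : IsIntegrallyClosed T := by
  classical
  refine isIntegrallyClosed_of_forall_finset fun s => ?_
  let F : Finset G := s.biUnion fun x => (decompose ℬ x).support
  let L : Submodule ℤ G := Submodule.span ℤ F
  -- The degrees of nonzero homogeneous elements form a group, so even the basis vectors of the span
  -- `L` are such degrees.
  have hL : L ≤ AddSubgroup.toIntSubmodule (degreeSupport ℬ hu) := by
    refine Submodule.span_le.mpr fun γ hγ => ?_
    obtain ⟨x, -, hx⟩ := Finset.mem_biUnion.mp (Finset.mem_coe.mp hγ)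
    exact ⟨decompose ℬ x γ, SetLike.coe_mem _, by simpa using hx⟩
  have : Module.Finite ℤ L := Module.Finite.span_finset ℤ F
  obtain ⟨n, b⟩ := Module.basisOfFiniteTypeTorsionFree' (R := ℤ) (M := L)
  have hb (i : Fin n) : ∃ x ∈ ℬ (b i : G), x ≠ 0 := hL (b i).2
  choose t ht t0 using hb
  refine ⟨monomialLocalization ℬ t, isIntegrallyClosed_monomialLocalization ℬ hu ht t0 ?_, ?_⟩
  · exact b.linearIndependent.map' L.subtype (Submodule.ker_subtype L)
  intro x hx
  rw [← sum_support_decompose ℬ x]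
  refine sum_mem fun γ hγ => ?_
  have hγL : γ ∈ L := Submodule.subset_span (Finset.mem_biUnion.mpr ⟨x, hx, hγ⟩)
  refine mem_monomialLocalization ℬ hu ht t0 (fun i => b.repr ⟨γ, hγL⟩ i) ?_
  have h := congrArg Subtype.val (b.sum_repr ⟨γ, hγL⟩)
  simp only [AddSubmonoidClass.coe_finsetSum, Submodule.coe_smul] at h
  rw [h]
  exact SetLike.coe_mem _

/-! ### Valuations of coefficients of products -/

/-- Only the finitely many elements of `A ∪ B` matter; the submonoid they generate is finitely
generated, cancellative and torsion-free. -/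
theorem uniqueSums_of_isAddTorsionFree (M : Type*) [AddCancelCommMonoid M] [IsAddTorsionFree M] :
    UniqueSums M where
  uniqueAdd_of_nonempty {A B} hA hB := by
    classical
    let N : AddSubmonoid M := AddSubmonoid.closure (↑(A ∪ B) : Set M)
    have hN (x : M) (hx : x ∈ A ∪ B) : x ∈ N := AddSubmonoid.subset_closure hx
    have hfg : AddMonoid.FG N := (AddMonoid.fg_iff_addSubmonoid_fg N).mpr ⟨_, rfl⟩
    have htf : IsAddTorsionFree N :=
      ⟨fun n hn a b h => Subtype.ext (IsAddTorsionFree.nsmul_right_injective hn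
        (congrArg Subtype.val h))⟩
    let _ : AddCancelCommMonoid N :=
      { (inferInstance : AddCommMonoid N) with
        add_left_cancel := fun a b c h =>
          Subtype.ext (add_left_cancel (congrArg Subtype.val h : (a : M) + b = a + c)) }
    have : TwoUniqueSums N := AffineAddMonoid.to_twoUniqueSums
    obtain ⟨a, ha, b, hb, h⟩ := UniqueSums.uniqueAdd_of_nonempty (G := N)
      (A := A.subtype (· ∈ N)) (B := B.subtype (· ∈ N))
      (hA.elim fun x hx => ⟨⟨x, hN x (Finset.mem_union_left _ hx)⟩, by simpa using hx⟩)
      (hB.elim fun x hx => ⟨⟨x, hN x (Finset.mem_union_right _ hx)⟩, by simpa using hx⟩)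
    refine ⟨a, by simpa using ha, b, by simpa using hb, fun x y hx hy hxy => ?_⟩
    have := @h ⟨x, hN x (Finset.mem_union_left _ hx)⟩ ⟨y, hN y (Finset.mem_union_right _ hy)⟩
      (by simpa using hx) (by simpa using hy) (Subtype.ext hxy)
    exact ⟨congrArg Subtype.val this.1, congrArg Subtype.val this.2⟩

/-- The Gauss extension of a valuation to a monoid algebra is multiplicative. -/
theorem exists_valuation_mul_le {K Γ₀ M : Type*} [Field K] [LinearOrderedCommGroupWithZero Γ₀]
    (v : Valuation K Γ₀) [AddCommMonoid M] [UniqueSums M] (F G : AddMonoidAlgebra K M) :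
    ∃ m, ∀ i j, v (F.coeff i * G.coeff j) ≤ v ((F * G).coeff m) := by
  classical
  by_cases hF : F.coeff.support.Nonempty
  swap
  · refine ⟨0, fun i j => ?_⟩
    simp [Finsupp.support_eq_empty.mp (Finset.not_nonempty_iff_eq_empty.mp hF)]
  by_cases hG : G.coeff.support.Nonempty
  swap
  · refine ⟨0, fun i j => ?_⟩
    simp [Finsupp.support_eq_empty.mp (Finset.not_nonempty_iff_eq_empty.mp hG)]
  have key (F : AddMonoidAlgebra K M) (hF : F.coeff.support.Nonempty) :
      ∃ s : Γ₀, 0 < s ∧ (∀ i, v (F.coeff i) ≤ s) ∧ ∃ i, v (F.coeff i) = s := by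
    obtain ⟨i, hi, h⟩ := Finset.exists_max_image F.coeff.support (fun i => v (F.coeff i)) hF
    refine ⟨_, (Valuation.pos_iff v).mpr (Finsupp.mem_support_iff.mp hi), fun j => ?_, i, rfl⟩
    by_cases hj : j ∈ F.coeff.support
    · exact h j hj
    · simp [Finsupp.notMem_support_iff.mp hj]
  obtain ⟨s, s0, hs, i₀, hi₀⟩ := key F hF
  obtain ⟨t, t0, ht, j₀, hj₀⟩ := key G hG
  -- Unique sums are applied to the exponents where the values are maximal. In degree `a + b`
  -- exactly one term then has value `s * t`, and all others are smaller.
  obtain ⟨a, ha, b, hb, hab⟩ := UniqueSums.uniqueAdd_of_nonempty (G := M)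
    (A := {i ∈ F.coeff.support | v (F.coeff i) = s}) (B := {j ∈ G.coeff.support | v (G.coeff j) = t})
    ⟨i₀, by simp [hi₀]; rintro h; simp [h] at hi₀; exact s0.ne hi₀⟩
    ⟨j₀, by simp [hj₀]; rintro h; simp [h] at hj₀; exact t0.ne hj₀⟩
  simp only [Finset.mem_filter] at ha hb
  refine ⟨a + b, fun i j => ?_⟩
  suffices v ((F * G).coeff (a + b)) = s * t by
    rw [this, map_mul]; exact mul_le_mul' (hs i) (ht j)
  have hst : 0 < s * t := by positivity
  have hsum : (F * G).coeff (a + b) = F.coeff a * G.coeff b +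
      ∑ p ∈ (F.coeff.support ×ˢ G.coeff.support).erase (a, b),
        if p.1 + p.2 = a + b then F.coeff p.1 * G.coeff p.2 else 0 := by
    rw [AddMonoidAlgebra.coeff_mul]
    simp only [Finsupp.sum]
    rw [← Finset.sum_product',
      ← Finset.add_sum_erase _ _ (Finset.mk_mem_product ha.1 hb.1)]
    simp
  have hval : v (F.coeff a * G.coeff b) = s * t := by rw [map_mul, ha.2, hb.2]
  rw [hsum, Valuation.map_add_eq_of_lt_left, hval]
  rw [hval]
  refine Valuation.map_sum_lt v hst.ne' fun p hp => ?_
  split_ifs with h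
  swap
  · simpa using hst
  obtain ⟨hne, hp⟩ := Finset.mem_erase.mp hp
  have hp := Finset.mem_product.mp hp
  rw [map_mul]
  refine (mul_le_mul' (hs p.1) (ht p.2)).lt_of_ne fun heq => hne ?_
  -- Equality with `s * t` forces both factors to be maximal, so uniqueness of the sum identifies
  -- `p` with the erased pair.
  have h1 : v (F.coeff p.1) = s := by
    refine (hs p.1).antisymm (not_lt.mp fun hlt => heq.not_lt ?_)
    exact (mul_le_mul_right (ht p.2) _).trans_lt (mul_lt_mul_of_pos_right hlt t0)
  have h2 : v (G.coeff p.2) = t := by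
    rw [h1] at heq
    exact mul_left_cancel₀ s0.ne' heq
  have := hab (Finset.mem_filter.mpr ⟨hp.1, h1⟩) (Finset.mem_filter.mpr ⟨hp.2, h2⟩) h
  exact Prod.ext this.1 this.2

/-! ### Sums and products of submodules -/

theorem submodule_sum_eq_iSup {R M ι : Type*} [Semiring R] [AddCommMonoid M] [Module R M]
    (s : Finset ι) (E : ι → Submodule R M) : ∑ i ∈ s, E i = ⨆ i ∈ s, E i := by
  classical
  induction s using Finset.induction_on with
  | empty => simp
  | insert a s ha ih => rw [Finset.sum_insert ha, ih, Finset.iSup_insert, Submodule.add_eq_sup]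

theorem idealToField_mul {R K : Type*} [CommRing R] [Field K] [Algebra R K] (I J : Ideal R) :
    idealToField K (I * J) = idealToField K I * idealToField K J :=
  Submodule.map_mul I J (Algebra.ofId R K)

section HomogeneousQuotient

variable {Γ : Type*} [AddCancelCommMonoid Γ] [DecidableEq Γ] {R : Type*} [CommRing R] [IsDomain R]
  (𝒜 : Γ → AddSubgroup R) [GradedRing 𝒜] (K : Type*) [Field K] [Algebra R K] [IsFractionRing R K]

/-! ### The grading of the homogeneous quotient field -/

theorem homogQuotProj_of_mem {γ : Algebra.GrothendieckAddGroup Γ} {x : homogQuot 𝒜 K}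
    (hx : x ∈ homogQuotComponent 𝒜 K γ) : homogQuotProj 𝒜 K γ x = x := by
  let _ := Classical.decEq (Algebra.GrothendieckAddGroup Γ)
  exact decompose_of_mem_same (homogQuotComponent 𝒜 K) hx

theorem homogQuotProj_of_mem_ne {γ δ : Algebra.GrothendieckAddGroup Γ} {x : homogQuot 𝒜 K}
    (hx : x ∈ homogQuotComponent 𝒜 K γ) (h : γ ≠ δ) : homogQuotProj 𝒜 K δ x = 0 := by
  let _ := Classical.decEq (Algebra.GrothendieckAddGroup Γ)
  exact decompose_of_mem_ne (homogQuotComponent 𝒜 K) hx h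

variable {𝒜 K} in
theorem homogQuot_induction {P : homogQuot 𝒜 K → Prop} (zero : P 0)
    (homogeneous : ∀ γ, ∀ x ∈ homogQuotComponent 𝒜 K γ, P x)
    (add : ∀ x y, P x → P y → P (x + y)) (x : homogQuot 𝒜 K) : P x := by
  classical
  exact Decomposition.inductionOn (homogQuotComponent 𝒜 K) zero
    (fun m => homogeneous _ m m.2) add x

theorem mem_of_forall_homogQuotProj_mem {x : homogQuot 𝒜 K} {E : Submodule R K}
    (h : ∀ γ, (homogQuotProj 𝒜 K γ x : K) ∈ E) : (x : K) ∈ E := by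
  let _ := Classical.decEq (Algebra.GrothendieckAddGroup Γ)
  let _ (γ) (y : homogQuotComponent 𝒜 K γ) : Decidable (y ≠ 0) := Classical.dec _
  rw [← sum_support_decompose (homogQuotComponent 𝒜 K) x, AddSubmonoidClass.coe_finsetSum]
  exact sum_mem fun γ _ => h γ

theorem isUnit_of_mem_homogQuotComponent {γ : Algebra.GrothendieckAddGroup Γ} {x : homogQuot 𝒜 K}
    (hx : x ∈ homogQuotComponent 𝒜 K γ) (x0 : x ≠ 0) : IsUnit x := by
  obtain rfl | ⟨α, β, -, a, ha, h, hh, h0, e⟩ := hx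
  · exact absurd rfl x0
  have xK0 : (x : K) ≠ 0 := by simpa using x0
  have a0 : a ≠ 0 := by rintro rfl; simp at e; exact x0 e
  refine IsUnit.of_mul_eq_one ⟨(x : K)⁻¹, h, a, ⟨⟨α, ha⟩, mem_nonZeroDivisors_of_ne_zero a0⟩, ?_⟩
    (Subtype.ext (mul_inv_cancel₀ xK0))
  rw [e, inv_div, div_eq_mul_inv]

/-- This places elements integral over `R` in `R_H`, where homogeneous components make sense. -/
theorem isIntegrallyClosed_homogQuot [IsAddTorsionFree Γ] : IsIntegrallyClosed (homogQuot 𝒜 K) := by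
  classical
  have : IsAddTorsionFree (Algebra.GrothendieckAddGroup Γ) :=
    AddLocalization.instIsAddTorsionFree (S := (⊤ : AddSubmonoid Γ))
  exact isIntegrallyClosed_of_isUnit_homogeneous (homogQuotComponent 𝒜 K)
    fun _ _ => isUnit_of_mem_homogQuotComponent 𝒜 K

theorem homogQuotProj_algebraMap_deg (α : Γ) (a : R) :
    homogQuotProj 𝒜 K (deg α) (algebraMap R _ a) = algebraMap R _ (GradedRing.proj 𝒜 α a) := by
  induction a using Decomposition.inductionOn 𝒜 with
  | zero => simp
  | @homogeneous β b =>
    by_cases h : β = α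
    · subst h
      rw [homogQuotProj_of_mem 𝒜 K (algebraMap_mem_component 𝒜 K b.2), GradedRing.proj_apply,
        decompose_of_mem_same 𝒜 b.2]
    · rw [homogQuotProj_of_mem_ne 𝒜 K (algebraMap_mem_component 𝒜 K b.2)
        (deg_injective.ne h), GradedRing.proj_apply, decompose_of_mem_ne 𝒜 b.2 h, map_zero]
  | add a b ha hb => simp only [map_add, ha, hb]

theorem homogQuotProj_algebraMap_of_notMem_range {γ : Algebra.GrothendieckAddGroup Γ}
    (hγ : ∀ α : Γ, deg α ≠ γ) (a : R) : homogQuotProj 𝒜 K γ (algebraMap R _ a) = 0 := by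
  induction a using Decomposition.inductionOn 𝒜 with
  | zero => simp
  | homogeneous b => exact homogQuotProj_of_mem_ne 𝒜 K (algebraMap_mem_component 𝒜 K b.2) (hγ _)
  | add a b ha hb => simp only [map_add, ha, hb, add_zero]

theorem homogQuotProj_algebraMap_mem_one (γ : Algebra.GrothendieckAddGroup Γ) (a : R) :
    (homogQuotProj 𝒜 K γ (algebraMap R _ a) : K) ∈ (1 : Submodule R K) := by
  by_cases h : ∃ α : Γ, deg α = γ
  · obtain ⟨α, rfl⟩ := h
    rw [homogQuotProj_algebraMap_deg]
    exact Submodule.mem_one.mpr ⟨_, rfl⟩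
  · rw [homogQuotProj_algebraMap_of_notMem_range 𝒜 K fun α hα => h ⟨α, hα⟩]
    exact zero_mem _

/-! ### Polynomials over the homogeneous quotient field in a monoid algebra -/

/-- The embedding of `R_H` into the monoid algebra that records homogeneous components. -/
def componentsRingHom :
    homogQuot 𝒜 K →+* AddMonoidAlgebra K (Algebra.GrothendieckAddGroup Γ × ℕ) :=
  letI := Classical.decEq (Algebra.GrothendieckAddGroup Γ)
  (DirectSum.toSemiring
    (fun γ => (AddMonoidAlgebra.singleAddHom (γ, 0)).comp
      ((homogQuot 𝒜 K).subtype.toAddMonoidHom.comp (homogQuotComponent 𝒜 K γ).subtype))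
    rfl
    (by
      intro γ δ x y
      exact (AddMonoidAlgebra.single_mul_single (γ, 0) (δ, 0) (x : K) (y : K)).symm)).comp
  (DirectSum.decomposeRingEquiv (homogQuotComponent 𝒜 K)).toRingHom

theorem componentsRingHom_of_mem {γ : Algebra.GrothendieckAddGroup Γ} {x : homogQuot 𝒜 K}
    (hx : x ∈ homogQuotComponent 𝒜 K γ) :
    componentsRingHom 𝒜 K x = AddMonoidAlgebra.single (γ, 0) (x : K) := by
  let _ := Classical.decEq (Algebra.GrothendieckAddGroup Γ)
  change DirectSum.toAddMonoid _ (decompose (homogQuotComponent 𝒜 K) x) = _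
  rw [decompose_of_mem _ hx, DirectSum.toAddMonoid_of]
  rfl

/-- The embedding of `R_H[X]` into the monoid algebra that records the homogeneous components of
the coefficients. -/
def polyComponents :
    (homogQuot 𝒜 K)[X] →+* AddMonoidAlgebra K (Algebra.GrothendieckAddGroup Γ × ℕ) :=
  eval₂RingHom (componentsRingHom 𝒜 K) (AddMonoidAlgebra.single (0, 1) 1)

theorem coeff_polyComponents (f : (homogQuot 𝒜 K)[X]) (γ : Algebra.GrothendieckAddGroup Γ) (i : ℕ) :
    (polyComponents 𝒜 K f).coeff (γ, i) = homogQuotProj 𝒜 K γ (f.coeff i) := by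
  induction f using Polynomial.induction_on' with
  | add p q hp hq => simp [hp, hq]
  | monomial n a =>
    induction a using homogQuot_induction with
    | zero => simp
    | add x y hx hy => simp only [map_add, AddMonoidAlgebra.coeff_add, Finsupp.add_apply, hx, hy,
        coeff_add, AddMemClass.coe_add]
    | homogeneous δ x hx =>
      have : polyComponents 𝒜 K (monomial n x) = AddMonoidAlgebra.single (δ, n) (x : K) := by
        simp [polyComponents, eval₂_monomial, componentsRingHom_of_mem 𝒜 K hx,
          AddMonoidAlgebra.single_pow]
      rw [this, coeff_monomial, AddMonoidAlgebra.coeff_single]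
      by_cases hn : n = i
      · subst hn
        by_cases hd : δ = γ
        · subst hd
          simp [homogQuotProj_of_mem 𝒜 K hx]
        · simp [homogQuotProj_of_mem_ne 𝒜 K hx hd, hd]
      · simp [hn]

/-! ### Content -/

variable {𝒜 K} in
theorem contentQuot_le_iff {f : (homogQuot 𝒜 K)[X]} {E : Submodule R K} :
    contentQuot 𝒜 K f ≤ E ↔ ∀ γ i, (homogQuotProj 𝒜 K γ (f.coeff i) : K) ∈ E := by
  have hc (x : homogQuot 𝒜 K) :
      componentSubmodule 𝒜 K x ≤ E ↔ ∀ γ, (homogQuotProj 𝒜 K γ x : K) ∈ E := by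
    rw [componentSubmodule, Submodule.span_le, Set.range_subset_iff]; rfl
  rw [contentQuot, submodule_sum_eq_iSup]
  simp only [iSup_le_iff, hc, Finset.mem_range]
  refine ⟨fun h γ i => ?_, fun h i _ γ => h γ i⟩
  by_cases hi : i < f.natDegree + 1
  · exact h i hi γ
  -- Coefficients beyond the degree vanish, so the index can range over all of `ℕ`.
  · rw [coeff_eq_zero_of_natDegree_lt (by omega), map_zero]
    exact zero_mem _

theorem homogQuotProj_coeff_mem_contentQuot (f : (homogQuot 𝒜 K)[X])
    (γ : Algebra.GrothendieckAddGroup Γ) (i : ℕ) :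
    (homogQuotProj 𝒜 K γ (f.coeff i) : K) ∈ contentQuot 𝒜 K f :=
  contentQuot_le_iff.mp le_rfl γ i

theorem coeff_mem_contentQuot (f : (homogQuot 𝒜 K)[X]) (i : ℕ) :
    (f.coeff i : K) ∈ contentQuot 𝒜 K f :=
  mem_of_forall_homogQuotProj_mem 𝒜 K fun γ => homogQuotProj_coeff_mem_contentQuot 𝒜 K f γ i

/-- Through this, contents of products are computed by multiplication in the monoid algebra. -/
theorem contentQuot_eq_span (f : (homogQuot 𝒜 K)[X]) :
    contentQuot 𝒜 K f = Submodule.span R (Set.range (polyComponents 𝒜 K f).coeff) := by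
  refine le_antisymm (contentQuot_le_iff.mpr fun γ i => ?_) (Submodule.span_le.mpr ?_)
  · rw [← coeff_polyComponents]
    exact Submodule.subset_span ⟨_, rfl⟩
  · rintro _ ⟨⟨γ, i⟩, rfl⟩
    rw [coeff_polyComponents]
    exact homogQuotProj_coeff_mem_contentQuot 𝒜 K f γ i

theorem contentQuot_ne_bot {f : (homogQuot 𝒜 K)[X]} (hf : f ≠ 0) : contentQuot 𝒜 K f ≠ ⊥ := by
  intro h
  refine hf (Polynomial.ext fun i => Subtype.ext ?_)
  simpa [h] using coeff_mem_contentQuot 𝒜 K f i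

theorem contentQuot_mul_le (f g : (homogQuot 𝒜 K)[X]) :
    contentQuot 𝒜 K (f * g) ≤ contentQuot 𝒜 K f * contentQuot 𝒜 K g := by
  classical
  rw [contentQuot_eq_span, Submodule.span_le]
  rintro _ ⟨m, rfl⟩
  rw [map_mul, AddMonoidAlgebra.coeff_mul]
  refine sum_mem fun p _ => sum_mem fun q _ => ?_
  dsimp only
  split_ifs
  · rw [contentQuot_eq_span, contentQuot_eq_span]
    exact Submodule.mul_mem_mul (Submodule.subset_span ⟨p, rfl⟩) (Submodule.subset_span ⟨q, rfl⟩)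
  · exact zero_mem _

theorem contentQuot_map_le_one (f : R[X]) :
    contentQuot 𝒜 K (f.map (algebraMap R (homogQuot 𝒜 K))) ≤ 1 :=
  contentQuot_le_iff.mpr fun γ i => by
    rw [coeff_map]
    exact homogQuotProj_algebraMap_mem_one 𝒜 K γ _

/-- Elements of `R` have no components in degrees outside `Γ`, so grading by `⟨Γ⟩` adds no
generators. -/
theorem idealToField_content (f : R[X]) :
    idealToField K (content 𝒜 f) = contentQuot 𝒜 K (f.map (algebraMap R (homogQuot 𝒜 K))) := by
  refine le_antisymm ?_ (contentQuot_le_iff.mpr fun γ i => ?_)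
  · rw [idealToField, Submodule.map_le_iff_le_comap, content, submodule_sum_eq_iSup]
    refine iSup₂_le fun i _ => Submodule.span_le.mpr ?_
    rintro _ ⟨α, rfl⟩
    have := homogQuotProj_coeff_mem_contentQuot 𝒜 K (f.map (algebraMap R (homogQuot 𝒜 K)))
      (deg α) i
    rw [coeff_map, homogQuotProj_algebraMap_deg] at this
    exact this
  · rw [coeff_map]
    by_cases h : ∃ α : Γ, deg α = γ
    · obtain ⟨α, rfl⟩ := h
      rw [homogQuotProj_algebraMap_deg]
      refine ⟨GradedRing.proj 𝒜 α (f.coeff i), ?_, rfl⟩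
      by_cases hi : i ∈ Finset.range (f.natDegree + 1)
      · rw [content, submodule_sum_eq_iSup]
        exact Submodule.mem_iSup_of_mem i (Submodule.mem_iSup_of_mem hi
          (Ideal.subset_span ⟨α, rfl⟩))
      · rw [coeff_eq_zero_of_natDegree_lt (by simpa [Nat.lt_succ_iff] using hi), map_zero]
        exact zero_mem _
    · rw [homogQuotProj_algebraMap_of_notMem_range 𝒜 K fun α hα => h ⟨α, hα⟩]
      exact zero_mem _

end HomogeneousQuotient

/-! ### The `v`-operation -/

section Inverse

variable {R : Type*} [CommRing R] {K : Type*} [Field K] [Algebra R K]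

theorem mem_inverse {E : Submodule R K} {x : K} :
    x ∈ inverse E ↔ ∀ y ∈ E, x * y ∈ (1 : Submodule R K) :=
  Submodule.mem_div_iff_forall_mul_mem

theorem inverse_anti {E F : Submodule R K} (h : E ≤ F) : inverse F ≤ inverse E := fun _ hx =>
  mem_inverse.mpr fun y hy => mem_inverse.mp hx y (h hy)

theorem vClosure_mono {E F : Submodule R K} (h : E ≤ F) : vClosure E ≤ vClosure F :=
  inverse_anti (inverse_anti h)

theorem le_vClosure (E : Submodule R K) : E ≤ vClosure E := fun x hx =>
  mem_inverse.mpr fun y hy => mul_comm x y ▸ mem_inverse.mp hy x hx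

theorem vClosure_vClosure (E : Submodule R K) : vClosure (vClosure E) = vClosure E :=
  (inverse_anti (le_vClosure (inverse E))).antisymm (le_vClosure (vClosure E))

theorem inverse_one : inverse (1 : Submodule R K) = 1 := by
  refine le_antisymm (fun x hx => ?_) fun x hx => mem_inverse.mpr fun y hy => ?_
  · simpa using mem_inverse.mp hx 1 (Submodule.one_le.mp le_rfl)
  · simpa using Submodule.mul_mem_mul hx hy

theorem inverse_smul {x : K} (hx : x ≠ 0) (E : Submodule R K) :
    inverse (x • E) = x⁻¹ • inverse E := by
  ext y
  rw [mem_inverse, Submodule.mem_smul_pointwise_iff_exists]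
  constructor
  · intro h
    refine ⟨x * y, mem_inverse.mpr fun e he => ?_, by simp [hx]⟩
    convert h (x • e) (Submodule.smul_mem_pointwise_smul _ _ _ he) using 1
    simp only [smul_eq_mul]; ring
  · rintro ⟨z, hz, rfl⟩ w hw
    obtain ⟨e, he, rfl⟩ := Submodule.mem_smul_pointwise_iff_exists _ _ _ |>.mp hw
    convert mem_inverse.mp hz e he using 1
    simp only [smul_eq_mul]; field_simp

variable (R K) in
/-- The `v`-operation as a semistar operation. -/
def vOperation [IsDomain R] [IsFractionRing R K] : SemistarOperation R K where
  star := vClosure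
  star_smul x E hx _ := by
    rw [vClosure, inverse_smul hx, inverse_smul (inv_ne_zero hx), inv_inv, vClosure]
  star_mono _ _ _ _ h := vClosure_mono h
  le_star E _ := le_vClosure E
  star_star E _ := vClosure_vClosure E

theorem isSemiStar_vOperation [IsDomain R] [IsFractionRing R K] : (vOperation R K).IsSemiStar := by
  change vClosure (1 : Submodule R K) = 1
  rw [vClosure, inverse_one, inverse_one]

end Inverse

/-! ### Coefficients of polynomials in submodules of `K[X]` -/

section Coefficients

variable {R : Type*} [CommRing R] {K : Type*} [Field K] [Algebra R K]

theorem mem_basePoly {p : K[X]} : p ∈ basePoly R K ↔ ∀ i, p.coeff i ∈ (1 : Submodule R K) := by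
  have h : p ∈ basePoly R K ↔ p ∈ (mapRingHom (algebraMap R K)).range := Iff.rfl
  rw [h, mem_map_range]
  simp [Submodule.mem_one]

theorem mem_overringPoly {T : Subalgebra R K} {p : K[X]} :
    p ∈ overringPoly T ↔ ∀ i, p.coeff i ∈ T := by
  have h : p ∈ overringPoly T ↔ p ∈ (mapRingHom (T.val : T →+* K)).range := Iff.rfl
  rw [h, mem_map_range]
  simp

theorem mem_extend {E : Submodule R K} {p : K[X]} : p ∈ extend E ↔ ∀ i, p.coeff i ∈ E := by
  constructor
  · intro hp
    rw [extend] at hp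
    refine Submodule.mul_induction_on hp ?_ fun p q hp hq i => ?_
    · rintro _ ⟨e, he, rfl⟩ q hq i
      have hq := mem_basePoly.mp hq i
      obtain ⟨r, hr⟩ := Submodule.mem_one.mp hq
      change (C e * q).coeff i ∈ E
      rw [coeff_C_mul, ← hr, mul_comm, ← Algebra.smul_def]
      exact E.smul_mem r he
    · rw [coeff_add]
      exact add_mem (hp i) (hq i)
  · intro h
    rw [p.as_sum_range_C_mul_X_pow, extend]
    refine sum_mem fun i _ => Submodule.mul_mem_mul ⟨p.coeff i, h i, rfl⟩ ?_
    exact ⟨X ^ i, by simp⟩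

end Coefficients

/-! ### Integral closure and valuations -/

/-- An integrally closed domain is the intersection of the valuation rings of its quotient field
that contain it. -/
theorem mem_one_of_forall_mem_valuationSubring {R : Type*} [CommRing R] [IsDomain R] {K : Type*}
    [Field K] [Algebra R K] [IsFractionRing R K] [IsIntegrallyClosed R] {x : K}
    (h : ∀ V : ValuationSubring K, (algebraMap R K).range ≤ V.toSubring → x ∈ V) :
    x ∈ (1 : Submodule R K) := by
  have : IsIntegrallyClosedIn (algebraMap R K).range K := by
    refine Subring.isIntegrallyClosedIn_iff.mpr ?_
    rintro y ⟨p, hp, hpy⟩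
    obtain ⟨q, rfl, -, hq⟩ := lifts_and_natDegree_eq_and_monic
      ((mem_lifts p).mpr (map_surjective _ (algebraMap R K).rangeRestrict_surjective p)) hp
    refine (isIntegrallyClosed_iff K).mp ‹_› ⟨q, hq, ?_⟩
    rw [eval₂_map] at hpy
    exact hpy
  by_contra hx
  obtain ⟨V, hV, hxV⟩ := Subring.exists_le_valuationSubring_of_isIntegrallyClosedIn
    (R := (algebraMap R K).range) (x := x) fun hx' => hx (Submodule.mem_one.mpr hx')
  exact hxV (h V hV)

/-! ### The content formula and integral elements -/

section HomogeneousQuotient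

variable {Γ : Type*} [AddCancelCommMonoid Γ] [DecidableEq Γ] {R : Type*} [CommRing R] [IsDomain R]
  (𝒜 : Γ → AddSubgroup R) [GradedRing 𝒜] (K : Type*) [Field K] [Algebra R K] [IsFractionRing R K]

theorem inverse_contentQuot_mul [IsAddTorsionFree Γ] [IsIntegrallyClosed R]
    (f g : (homogQuot 𝒜 K)[X]) :
    inverse (contentQuot 𝒜 K f * contentQuot 𝒜 K g) = inverse (contentQuot 𝒜 K (f * g)) := by
  refine (inverse_anti (contentQuot_mul_le 𝒜 K f g)).antisymm fun x hx => ?_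
  suffices h : contentQuot 𝒜 K f * contentQuot 𝒜 K g ≤ (1 : Submodule R K).comap
      (LinearMap.mulLeft R x) from mem_inverse.mpr fun y hy => h hy
  rw [contentQuot_eq_span, contentQuot_eq_span, Submodule.span_mul_span, Submodule.span_le]
  rintro _ ⟨_, ⟨p, rfl⟩, _, ⟨q, rfl⟩, rfl⟩
  refine mem_one_of_forall_mem_valuationSubring fun V hV => ?_
  have : IsAddTorsionFree (Algebra.GrothendieckAddGroup Γ) :=
    AddLocalization.instIsAddTorsionFree (S := (⊤ : AddSubmonoid Γ))
  have := uniqueSums_of_isAddTorsionFree (Algebra.GrothendieckAddGroup Γ)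
  -- The index `m` depends on `V`, but `x` times any coefficient of the product lies in `R`, hence
  -- in `V`.
  obtain ⟨m, hm⟩ := exists_valuation_mul_le V.valuation (polyComponents 𝒜 K f)
    (polyComponents 𝒜 K g)
  rw [← map_mul] at hm
  obtain ⟨r, hr⟩ := Submodule.mem_one.mp (mem_inverse.mp hx ((polyComponents 𝒜 K (f * g)).coeff m)
    (contentQuot_eq_span 𝒜 K _ ▸ Submodule.subset_span ⟨m, rfl⟩))
  have hxm : V.valuation (x * (polyComponents 𝒜 K (f * g)).coeff m) ≤ 1 :=
    (V.valuation_le_one_iff _).mpr (hV ⟨r, hr⟩)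
  rw [← V.valuation_le_one_iff]
  refine le_trans ?_ hxm
  simp only [LinearMap.mulLeft_apply]
  rw [map_mul V.valuation x, map_mul V.valuation x]
  exact mul_le_mul_right (hm p q) _

theorem vClosure_contentQuot_mul [IsAddTorsionFree Γ] [IsIntegrallyClosed R]
    (f g : (homogQuot 𝒜 K)[X]) :
    vClosure (contentQuot 𝒜 K f * contentQuot 𝒜 K g) = vClosure (contentQuot 𝒜 K (f * g)) :=
  congrArg inverse (inverse_contentQuot_mul 𝒜 K f g)

/-- An element of `K` integral over `R` lies in `R_H`, and gives a linear factor in `R_H[X]` of a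
monic polynomial over `R`. -/
theorem exists_linear_mul_eq_of_isIntegral [IsAddTorsionFree Γ] {u : K} (hu : IsIntegral R u) :
    ∃ u' : homogQuot 𝒜 K, (u' : K) = u ∧ ∃ q : (homogQuot 𝒜 K)[X], q.Monic ∧
      ∃ h : R[X], h.Monic ∧ (X - C u') * q = h.map (algebraMap R (homogQuot 𝒜 K)) := by
  have := isIntegrallyClosed_homogQuot 𝒜 K
  obtain ⟨u', hu'⟩ := (isIntegrallyClosed_iff (R := homogQuot 𝒜 K) K).mp this hu.tower_top
  obtain ⟨h, hh, hhu⟩ := hu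
  have hroot : (h.map (algebraMap R (homogQuot 𝒜 K))).IsRoot u' := by
    rw [IsRoot.def, eval_map]
    apply FaithfulSMul.algebraMap_injective (homogQuot 𝒜 K) K
    rw [hom_eval₂, map_zero, hu', ← IsScalarTower.algebraMap_eq]
    exact hhu
  obtain ⟨q, hq⟩ := dvd_iff_isRoot.mpr hroot
  exact ⟨u', hu', q, (monic_X_sub_C u').of_mul_monic_left (hq ▸ hh.map _), h, hh, hq.symm⟩

-- The denominator `s` is homogeneous, so that multiplying by it puts the content inside a principal
-- module, as `contentQuot_C_mul_map_le` shows.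
omit [IsDomain R] in
theorem exists_linear_map_eq (x : homogQuot 𝒜 K) :
    ∃ s ∈ nonzeroHomogeneous 𝒜, ∃ f : R[X],
      f.map (algebraMap R (homogQuot 𝒜 K)) = C (algebraMap R _ s) * (X - C x) := by
  obtain ⟨a, s, rfl⟩ := IsLocalization.exists_mk'_eq (nonzeroHomogeneous 𝒜) x
  refine ⟨s, s.2, C (s : R) * X - C a, ?_⟩
  rw [mul_sub, ← C_mul, mul_comm _ (IsLocalization.mk' _ _ _), IsLocalization.mk'_spec]
  simp

theorem contentQuot_C_mul_map_le {s : R} (hs : SetLike.IsHomogeneousElem 𝒜 s) (h : R[X]) :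
    contentQuot 𝒜 K (C (algebraMap R _ s) * h.map (algebraMap R (homogQuot 𝒜 K))) ≤
      Submodule.span R {algebraMap R K s} := by
  obtain ⟨α, hα⟩ := hs
  have h1 : contentQuot 𝒜 K (C (algebraMap R (homogQuot 𝒜 K) s)) ≤
      Submodule.span R {algebraMap R K s} := by
    refine contentQuot_le_iff.mpr fun γ i => ?_
    rw [coeff_C]
    split_ifs
    · by_cases hγ : deg α = γ
      · subst hγ
        rw [homogQuotProj_of_mem 𝒜 K (algebraMap_mem_component 𝒜 K hα)]
        exact Submodule.mem_span_singleton_self _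
      · rw [homogQuotProj_of_mem_ne 𝒜 K (algebraMap_mem_component 𝒜 K hα) hγ]
        exact zero_mem _
    · rw [map_zero]
      exact zero_mem _
  refine (contentQuot_mul_le 𝒜 K _ _).trans ?_
  simpa using mul_le_mul' h1 (contentQuot_map_le_one 𝒜 K h)

theorem inv_mem_inverse_contentQuot {s : R} (hs : SetLike.IsHomogeneousElem 𝒜 s) (s0 : s ≠ 0)
    (h : R[X]) :
    (algebraMap R K s)⁻¹ ∈ inverse (contentQuot 𝒜 K
      (C (algebraMap R _ s) * h.map (algebraMap R (homogQuot 𝒜 K)))) := by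
  refine mem_inverse.mpr fun y hy => ?_
  obtain ⟨r, rfl⟩ := Submodule.mem_span_singleton.mp (contentQuot_C_mul_map_le 𝒜 K hs h hy)
  have : algebraMap R K s ≠ 0 := by simpa using s0
  refine Submodule.mem_one.mpr ⟨r, ?_⟩
  rw [Algebra.smul_def]
  field_simp

/-- Some coefficient of `f` has a nonzero homogeneous component; `x` times it lies in `R`, so it
serves as a denominator for `x`. -/
theorem mem_homogQuot_of_mem_inverse {f : R[X]} (hf : f ≠ 0) {x : K}
    (hx : x ∈ inverse (contentQuot 𝒜 K (f.map (algebraMap R (homogQuot 𝒜 K))))) :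
    x ∈ homogQuot 𝒜 K := by
  obtain ⟨i, hi⟩ : ∃ i, f.coeff i ≠ 0 := by
    by_contra! h
    exact hf (Polynomial.ext h)
  obtain ⟨α, hα⟩ : ∃ α, GradedRing.proj 𝒜 α (f.coeff i) ≠ 0 := by
    by_contra! h
    refine hi ((decompose 𝒜).injective ?_)
    rw [decompose_zero]
    ext α
    exact h α
  have h1 := homogQuotProj_coeff_mem_contentQuot 𝒜 K (f.map (algebraMap R (homogQuot 𝒜 K)))
    (deg α) i
  rw [coeff_map, homogQuotProj_algebraMap_deg] at h1
  obtain ⟨r, hr⟩ := Submodule.mem_one.mp (mem_inverse.mp hx _ h1)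
  refine ⟨r, _, ⟨⟨α, SetLike.coe_mem _⟩, mem_nonZeroDivisors_of_ne_zero hα⟩, ?_⟩
  rw [hr]
  exact (mul_inv_cancel_right₀ (by simpa using hα) x).symm

omit [IsDomain R] in
theorem map_algebraMap_eq_map_val (f : R[X]) : f.map (algebraMap R K) =
    (f.map (algebraMap R (homogQuot 𝒜 K))).map (algebraMap (homogQuot 𝒜 K) K) := by
  rw [map_map, ← IsScalarTower.algebraMap_eq]

/-! ### The implications -/

theorem polyMul_overringPoly_inf_basePoly [IsAddTorsionFree Γ] [IsIntegrallyClosed R]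
    {f : R[X]} (hf : f ≠ 0) :
    polyMul (f.map (algebraMap R K)) (overringPoly (homogQuot 𝒜 K)) ⊓ basePoly R K =
      polyMul (f.map (algebraMap R K)) (extend (inverse (idealToField K (content 𝒜 f)))) := by
  rw [idealToField_content]
  refine le_antisymm ?_ (le_inf ?_ ?_)
  · rintro _ ⟨⟨_, ⟨g, rfl⟩, rfl⟩, hb⟩
    refine ⟨_, mem_extend.mpr fun i => ?_, rfl⟩
    -- That `1` lies in the inverse says the content is contained in `R`; the content formula
    -- transfers this to the product of the contents.
    have hone : (1 : K) ∈ inverse (contentQuot 𝒜 K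
        (f.map (algebraMap R (homogQuot 𝒜 K)) * g)) := by
      obtain ⟨h, hh⟩ := hb
      have e : f.map (algebraMap R (homogQuot 𝒜 K)) * g = h.map (algebraMap R _) := by
        apply map_injective (algebraMap (homogQuot 𝒜 K) K)
          (FaithfulSMul.algebraMap_injective (homogQuot 𝒜 K) K)
        rw [Polynomial.map_mul, ← map_algebraMap_eq_map_val, ← map_algebraMap_eq_map_val]
        exact hh.symm
      rw [e]
      exact mem_inverse.mpr fun y hy => by
        simpa using contentQuot_map_le_one 𝒜 K h hy
    rw [← inverse_contentQuot_mul] at hone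
    refine mem_inverse.mpr fun y hy => ?_
    have := mem_inverse.mp hone _ (Submodule.mul_mem_mul hy (coeff_mem_contentQuot 𝒜 K g i))
    rw [one_mul, mul_comm] at this
    simpa using this
  · rintro _ ⟨w, hw, rfl⟩
    exact ⟨w, mem_overringPoly.mpr fun i =>
      mem_homogQuot_of_mem_inverse 𝒜 K hf (mem_extend.mp hw i), rfl⟩
  · rintro _ ⟨w, hw, rfl⟩
    refine mem_basePoly.mpr fun i => ?_
    rw [LinearMap.mulLeft_apply, coeff_mul]
    refine sum_mem fun p _ => ?_
    rw [mul_comm, map_algebraMap_eq_map_val 𝒜, coeff_map]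
    exact mem_inverse.mp (mem_extend.mp hw _) _ (coeff_mem_contentQuot 𝒜 K _ _)

omit [IsDomain R] in
theorem isIntegrallyClosed_of_forall_isIntegral_mem_one
    (h : ∀ u : K, IsIntegral R u → u ∈ (1 : Submodule R K)) : IsIntegrallyClosed R :=
  (isIntegrallyClosed_iff K).mpr fun hu => Submodule.mem_one.mp (h _ hu)

/-- Clearing denominators gives `f = s(X - u)` and `g = tq`, so `fg = sth` has content inside `stR`.
The product `-su · t` lies in `𝒜_f 𝒜_g`, hence in the `v`-closure of `𝒜_{fg}`, and multiplying by
`(st)⁻¹` leaves `-u ∈ R`. -/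
theorem isIntegrallyClosed_of_vClosure_content_mul [IsAddTorsionFree Γ]
    (H : ∀ f g : R[X], f ≠ 0 → g ≠ 0 →
      vClosure (idealToField K (content 𝒜 f * content 𝒜 g)) =
        vClosure (idealToField K (content 𝒜 (f * g)))) : IsIntegrallyClosed R := by
  refine isIntegrallyClosed_of_forall_isIntegral_mem_one K fun u hu => ?_
  obtain ⟨x, rfl, q, hq, h, -, hqh⟩ := exists_linear_mul_eq_of_isIntegral 𝒜 K hu
  obtain ⟨s, hs, f, hf⟩ := exists_linear_map_eq 𝒜 K x
  obtain ⟨t, htH, ht⟩ := IsLocalization.integerNormalization_spec (nonzeroHomogeneous 𝒜) q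
  set g := IsLocalization.integerNormalization (nonzeroHomogeneous 𝒜) q
  have ht : g.map (algebraMap R (homogQuot 𝒜 K)) = C (algebraMap R _ t) * q := by
    rw [ht, ← algebraMap_smul (homogQuot 𝒜 K) t q, smul_eq_C_mul]
  have hst := mul_mem hs htH
  have s0 : s ≠ 0 := nonZeroDivisors.ne_zero hs.2
  have t0 : t ≠ 0 := nonZeroDivisors.ne_zero htH.2
  have hinj := FaithfulSMul.algebraMap_injective R (homogQuot 𝒜 K)
  have hC {r : R} (hr : r ≠ 0) : C (algebraMap R (homogQuot 𝒜 K) r) ≠ 0 := by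
    simpa [map_eq_zero_iff _ hinj] using hr
  have f0 : f ≠ 0 := by
    rintro rfl
    rw [Polynomial.map_zero] at hf
    exact mul_ne_zero (hC s0) (X_sub_C_ne_zero x) hf.symm
  have g0 : g ≠ 0 := by
    intro hg
    rw [hg, Polynomial.map_zero] at ht
    exact mul_ne_zero (hC t0) hq.ne_zero ht.symm
  have hfg : (f * g).map (algebraMap R (homogQuot 𝒜 K)) =
      C (algebraMap R _ (s * t)) * h.map (algebraMap R _) := by
    rw [Polynomial.map_mul, hf, ht, ← hqh, map_mul, C_mul]; ring
  have key := H f g f0 g0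
  rw [idealToField_mul, idealToField_content, idealToField_content, idealToField_content] at key
  have h1 := coeff_mem_contentQuot 𝒜 K (f.map (algebraMap R (homogQuot 𝒜 K))) 0
  have h2 := coeff_mem_contentQuot 𝒜 K (g.map (algebraMap R (homogQuot 𝒜 K))) q.natDegree
  have h3 := le_vClosure _ (Submodule.mul_mem_mul h1 h2)
  rw [key, hfg, hf, ht] at h3
  have h4 := mem_inverse.mp h3 _ (inv_mem_inverse_contentQuot 𝒜 K hst.1 (mul_ne_zero s0 t0) h)
  have i0 : algebraMap R K s ≠ 0 := by simpa using s0
  have j0 : algebraMap R K t ≠ 0 := by simpa using t0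
  have e (r : R) : ((algebraMap R (homogQuot 𝒜 K) r : homogQuot 𝒜 K) : K) = algebraMap R K r := rfl
  rw [← neg_mem_iff]
  convert h4 using 1
  simp [hq.coeff_natDegree, e]
  field_simp

/-- No denominators need clearing: `-u · 1` lies in the product of the contents of `X - u` and `q`,
whose star is that of the content of `h`, and this lies in `R^⋆ = R`. -/
theorem isIntegrallyClosed_of_star_contentQuot_mul [IsAddTorsionFree Γ]
    (s : SemistarOperation R K) (hs : s.IsSemiStar)
    (H : ∀ f g : (homogQuot 𝒜 K)[X], f ≠ 0 → g ≠ 0 → f.degree = 1 →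
      s.star (contentQuot 𝒜 K f * contentQuot 𝒜 K g) = s.star (contentQuot 𝒜 K (f * g))) :
    IsIntegrallyClosed R := by
  refine isIntegrallyClosed_of_forall_isIntegral_mem_one K fun u hu => ?_
  obtain ⟨x, rfl, q, hq, h, -, hqh⟩ := exists_linear_mul_eq_of_isIntegral 𝒜 K hu
  have key := H (X - C x) q (X_sub_C_ne_zero x) hq.ne_zero (degree_X_sub_C x)
  have hfq := contentQuot_ne_bot 𝒜 K (mul_ne_zero (X_sub_C_ne_zero x) hq.ne_zero)
  have h1 : s.star (contentQuot 𝒜 K ((X - C x) * q)) ≤ 1 := by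
    rw [← show s.star 1 = 1 from hs]
    exact s.star_mono _ _ hfq one_ne_zero (hqh ▸ contentQuot_map_le_one 𝒜 K h)
  have h2 := Submodule.mul_mem_mul (coeff_mem_contentQuot 𝒜 K (X - C x) 0)
    (coeff_mem_contentQuot 𝒜 K q q.natDegree)
  have h3 := h1 (key ▸ s.le_star _ (ne_bot_of_le_ne_bot hfq (contentQuot_mul_le 𝒜 K _ _)) h2)
  rw [← neg_mem_iff]
  convert h3 using 1
  simp [hq.coeff_natDegree]

/-- With `f = s(X - u)` and `w = s⁻¹q`, the product `fw = h` lies in `R[X]`. Statement 4 then puts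
the leading coefficient `s⁻¹` of `w` in the inverse of `𝒜_f`, which contains `-su`. -/
theorem isIntegrallyClosed_of_polyMul_overringPoly [IsAddTorsionFree Γ]
    (H : ∀ f : R[X], f ≠ 0 →
      polyMul (f.map (algebraMap R K)) (overringPoly (homogQuot 𝒜 K)) ⊓ basePoly R K =
        polyMul (f.map (algebraMap R K)) (extend (inverse (idealToField K (content 𝒜 f))))) :
    IsIntegrallyClosed R := by
  refine isIntegrallyClosed_of_forall_isIntegral_mem_one K fun u hu => ?_
  obtain ⟨x, rfl, q, hq, h, -, hqh⟩ := exists_linear_mul_eq_of_isIntegral 𝒜 K hu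
  obtain ⟨s, hs, f, hf⟩ := exists_linear_map_eq 𝒜 K x
  have s0 : s ≠ 0 := nonZeroDivisors.ne_zero hs.2
  have i0 : algebraMap R K s ≠ 0 := by simpa using s0
  have hfK : f.map (algebraMap R K) = C (algebraMap R K s) * (X - C (x : K)) := by
    rw [map_algebraMap_eq_map_val 𝒜, hf, Polynomial.map_mul, Polynomial.map_sub, map_X, map_C,
      map_C]
    rfl
  have fK0 : f.map (algebraMap R K) ≠ 0 := by
    rw [hfK]
    exact mul_ne_zero (by simpa using s0) (X_sub_C_ne_zero _)
  have f0 : f ≠ 0 := by rintro rfl; simp at fK0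
  let w : K[X] := C (algebraMap R K s)⁻¹ * q.map (algebraMap (homogQuot 𝒜 K) K)
  have hw : f.map (algebraMap R K) * w ∈
      polyMul (f.map (algebraMap R K)) (overringPoly (homogQuot 𝒜 K)) ⊓ basePoly R K := by
    refine ⟨⟨w, mem_overringPoly.mpr fun i => ?_, rfl⟩, h, ?_⟩
    · rw [coeff_C_mul, coeff_map]
      exact mul_mem ⟨1, s, hs, by simp⟩ (q.coeff i).2
    · change h.map (algebraMap R K) = _
      rw [map_algebraMap_eq_map_val 𝒜, ← hqh, hfK, Polynomial.map_mul, Polynomial.map_sub, map_X,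
        map_C, show algebraMap (homogQuot 𝒜 K) K x = (x : K) from rfl]
      have : C (algebraMap R K s) * C (algebraMap R K s)⁻¹ = 1 := by
        rw [← C_mul, mul_inv_cancel₀ i0, C_1]
      linear_combination -(X - C (x : K)) * q.map (algebraMap (homogQuot 𝒜 K) K) * this
  rw [H f f0] at hw
  obtain ⟨w', hw', e⟩ := hw
  -- Statement 4 only supplies some cofactor of `f`; cancelling `f` in `K[X]` shows that it is `w`.
  obtain rfl : w' = w := mul_left_cancel₀ fK0 e
  have h1 := mem_extend.mp hw' q.natDegree
  rw [idealToField_content] at h1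
  have h2 := mem_inverse.mp h1 _ (coeff_mem_contentQuot 𝒜 K _ 0)
  rw [hf] at h2
  rw [← neg_mem_iff]
  convert h2 using 1
  have e (r : R) : ((algebraMap R (homogQuot 𝒜 K) r : homogQuot 𝒜 K) : K) = algebraMap R K r := rfl
  simp [w, hq.coeff_natDegree, e]
  field_simp

end HomogeneousQuotient

end GradedDomain

end

theorem mainTheorem7 {Γ : Type*} [AddCancelCommMonoid Γ] [IsAddTorsionFree Γ] [DecidableEq Γ]
    {R : Type*} [CommRing R] [IsDomain R] (𝒜 : Γ → AddSubgroup R) [GradedRing 𝒜]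
    (K : Type*) [Field K] [Algebra R K] [IsFractionRing R K] :
    List.TFAE [
      IsIntegrallyClosed R,
      ∀ f g : R[X], f ≠ 0 → g ≠ 0 →
        GradedDomain.vClosure (GradedDomain.idealToField K
            (GradedDomain.content 𝒜 f * GradedDomain.content 𝒜 g)) =
          GradedDomain.vClosure (GradedDomain.idealToField K (GradedDomain.content 𝒜 (f * g))),
      ∃ s : GradedDomain.SemistarOperation R K, s.IsSemiStar ∧
        ∀ f g : (GradedDomain.homogQuot 𝒜 K)[X], f ≠ 0 → g ≠ 0 → f.degree = 1 →
          s.star (GradedDomain.contentQuot 𝒜 K f * GradedDomain.contentQuot 𝒜 K g) =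
            s.star (GradedDomain.contentQuot 𝒜 K (f * g)),
      ∀ f : R[X], f ≠ 0 →
        GradedDomain.polyMul (f.map (algebraMap R K))
            (GradedDomain.overringPoly (GradedDomain.homogQuot 𝒜 K)) ⊓
            GradedDomain.basePoly R K =
          GradedDomain.polyMul (f.map (algebraMap R K))
            (GradedDomain.extend (GradedDomain.inverse
              (GradedDomain.idealToField K (GradedDomain.content 𝒜 f))))] := by
  tfae_have 1 → 2 := by
    intro _ f g _ _
    rw [GradedDomain.idealToField_mul, GradedDomain.idealToField_content,
      GradedDomain.idealToField_content, GradedDomain.idealToField_content, Polynomial.map_mul]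
    exact GradedDomain.vClosure_contentQuot_mul 𝒜 K _ _
  tfae_have 1 → 3 := fun _ =>
    ⟨GradedDomain.vOperation R K, GradedDomain.isSemiStar_vOperation,
      fun f g _ _ _ => GradedDomain.vClosure_contentQuot_mul 𝒜 K f g⟩
  tfae_have 1 → 4 := fun _ _ hf => GradedDomain.polyMul_overringPoly_inf_basePoly 𝒜 K hf
  tfae_have 2 → 1 := GradedDomain.isIntegrallyClosed_of_vClosure_content_mul 𝒜 K
  tfae_have 3 → 1 := fun ⟨s, hs, H⟩ =>
    GradedDomain.isIntegrallyClosed_of_star_contentQuot_mul 𝒜 K s hs H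
  tfae_have 4 → 1 := GradedDomain.isIntegrallyClosed_of_polyMul_overringPoly 𝒜 K
  tfae_finish
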